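/- Let $d\ge 2$ and let $\gamma,p,\nu,\kappa,r\in\mathbb R$, with $c=\gamma-d-1$, satisfy $$p>1,\quad r>1,\quad \tfrac1r=\tfrac2p+\tfrac{2\nu+\kappa}{d}-1,\quad \kappa<\tfrac dr,\quad \tfrac{d-1}{2}\bigl(1-\tfrac2p\bigr)<\nu<d\,\tfrac{p-1}{p},$$ $$2r\ge p,\quad \max\{\nu,\kappa\}>0,\quad \nu+\kappa\ge(d-1)\bigl(\tfrac1r-\tfrac1p\bigr),\quad p>\tfrac{r}{r-1},$$ $$\max\{0,d+p(c+\nu)\}<\tfrac{d(r-p)}{r}+p(\nu+\kappa+1)<\tfrac{\gamma p(r-1)}{r},\quad \tfrac{\gamma p(r-1)}{r}-\tfrac{d(r-p)}{r}-p(\nu+\kappa+1)>\gamma.$$ For measurable $f:\mathbb R^d\to\mathbb C^d$ put $\|f\|_{u_\nu,p}=\bigl(\int_{\mathbb R^d}|f(x)|^p u_\nu(x)^p\,dx\bigr)^{1/p}$ with $u_\nu(x)=e^{|x|}|x|^\nu$. Let $\mathfrak R^p_{u_\nu}$ be the set of radial $f$ (depending only on $|x|$, up to null sets) with $\|f\|_{u_\nu,p}<\infty$,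 and let $\mathfrak{RL}^p_{u_\nu}$ be the set of $f$ with $\|f\|_{u_\nu,p}<\infty$ for which there is $\widehat f\in\mathfrak R^p_{u_\nu}$ with $|f|\le|\widehat f|$ almost everywhere. Consider the Fourier-side generalized Navier--Stokes integral equation $$v(y,t)=e^{-|y|^\gamma t}v(y,0)-i\int_0^t\int_{\mathbb R^d}\bigl(y\cdot v(y-z,s)\bigr)\,P_yv(z,s)\,e^{-|y|^\gamma(t-s)}\,dz\,ds,\qquad y\cdot v(y,t)=0,$$ for $0\le t<T$ and almost every $y\in\mathbb R^d$, where $P_yw=w-\frac{w\cdot y}{|y|^2}y$ and the integral converges absolutely. Then there is a constant $D>0$, depending only on the parameters above, such that for every $T>0$ and every $\vartheta\in\mathfrak{RL}^p_{u_\nu}$ with $\|\vartheta\|_{u_\nu,p}<D$: if the Leray self-similar field $$v(y,t)=(T-t)^{\frac{d+1-\gamma}{\gamma}}\,\vartheta\bigl(y\,(T-t)^{\frac1\gamma}\bigr)$$ solves this equation, then $\vartheta=0$ almost everywhere. In particular, the same holds for every $\vartheta\in\mathfrak R^p_{u_\nu}$ with $\|\vartheta\|_{u_\nu,p}<D$.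 -/

import Mathlib

open MeasureTheory Set

noncomputable section

namespace LerayBlowup

/-- Physical frequency space `ℝ^d` with the Euclidean norm. -/
abbrev RSp (d : ℕ) := EuclideanSpace ℝ (Fin d)

/-- `ℂ^d` with the Hermitian norm, i.e. the Euclidean norm of `ℝ^{2d}`. -/
abbrev CSp (d : ℕ) := EuclideanSpace ℂ (Fin d)

/-- The inclusion `ℝ^d ⊂ ℂ^d`. -/
def toC {d : ℕ} (y : RSp d) : CSp d := WithLp.toLp 2 fun j => (y j : ℂ)

/-- The (bilinear) scalar product `y · v = ∑ y_j v_j` of `y ∈ ℝ^d` and `v ∈ ℂ^d`. -/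
def dot {d : ℕ} (y : RSp d) (v : CSp d) : ℂ := ∑ j, (y j : ℂ) * v j

/-- The Leray projection `P_y v = v - (v · y) / |y|² y`. -/
def lerayProj {d : ℕ} (y : RSp d) (v : CSp d) : CSp d :=
  v - (dot y v / ((‖y‖ ^ 2 : ℝ) : ℂ)) • toC y

/-- The integrand `(y · v(y - z, s)) P_y v(z, s) e^{-|y|^γ (t - s)}`. -/
def nonlinearity {d : ℕ} (γ : ℝ) (v : RSp d → ℝ → CSp d) (y : RSp d) (t s : ℝ) (z : RSp d) :
    CSp d :=
  Real.exp (-‖y‖ ^ γ * (t - s)) • (dot y (v (y - z) s) • lerayProj y (v z s))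

/-- `v` is transversal and solves the Fourier-side integral equation on `[0, T)`
with initial datum `v(·, 0)`:
`v(y,t) = e^{-|y|^γ t} v(y,0) - i ∫_0^t ∫ (y · v(y-z,s)) P_y v(z,s) e^{-|y|^γ (t-s)} dz ds`,
the double integral being absolutely convergent. As `v(·, t)` is a class of functions modulo
null sets, everything is required for almost every `y`. -/
def SolvesNS {d : ℕ} (γ T : ℝ) (v : RSp d → ℝ → CSp d) : Prop :=
  (∀ t ∈ Ico (0 : ℝ) T, ∀ᵐ y : RSp d, dot y (v y t) = 0) ∧
  ∀ t ∈ Ioo (0 : ℝ) T, ∀ᵐ y : RSp d,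
    IntegrableOn (fun q : ℝ × RSp d => nonlinearity γ v y t q.1 q.2) (Ioc 0 t ×ˢ univ) ∧
    v y t = Real.exp (-‖y‖ ^ γ * t) • v y 0
      - Complex.I • ∫ s in (0 : ℝ)..t, ∫ z : RSp d, nonlinearity γ v y t s z

/-- The Leray self-similar field with profile `ϑ` and blow-up time `T`:
`v(y,t) = (T - t)^{(d+1-γ)/γ} ϑ(y (T - t)^{1/γ})`. -/
def selfSimilar {d : ℕ} (γ T : ℝ) (ϑ : RSp d → CSp d) (y : RSp d) (t : ℝ) : CSp d :=
  ((T - t) ^ (((d : ℝ) + 1 - γ) / γ)) • ϑ (((T - t) ^ (1 / γ)) • y)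

/-- The weight `u_ν(x) = e^{|x|} |x|^ν`. -/
def weight {d : ℕ} (ν : ℝ) (x : RSp d) : ℝ := Real.exp ‖x‖ * ‖x‖ ^ ν

/-- The weighted norm `(∫ |f|^p u_ν^p)^{1/p}`, with values in `[0, ∞]`. -/
def wNorm {d : ℕ} (p ν : ℝ) (f : RSp d → CSp d) : ENNReal :=
  eLpNorm (fun x => weight ν x • f x) (ENNReal.ofReal p) volume

/-- Measurable complex vector fields of finite weighted norm. -/
def MemWeighted {d : ℕ} (p ν : ℝ) (f : RSp d → CSp d) : Prop :=
  MemLp (fun x => weight ν x • f x) (ENNReal.ofReal p) volume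

/-- Vector fields depending on `|x|` only. -/
def IsRadial {d : ℕ} (f : RSp d → CSp d) : Prop := ∀ x y, ‖x‖ = ‖y‖ → f x = f y

/-- Radial elements of the weighted space (radial up to a null set). -/
def MemRadial {d : ℕ} (p ν : ℝ) (f : RSp d → CSp d) : Prop :=
  MemWeighted p ν f ∧ ∃ g : RSp d → CSp d, IsRadial g ∧ f =ᵐ[volume] g

/-- Radially dominated elements of the weighted space: `|f| ≤ |f̂|` for some radial element `f̂`
of the weighted space. -/
def MemRadiallyDominated {d : ℕ} (p ν : ℝ) (f : RSp d → CSp d) : Prop :=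
  MemWeighted p ν f ∧
    ∃ fhat : RSp d → CSp d, MemRadial p ν fhat ∧ ∀ᵐ x : RSp d, ‖f x‖ ≤ ‖fhat x‖

/-- The conditions on the exponents. -/
structure Admissible (d : ℕ) (γ p ν κ r : ℝ) : Prop where
  one_lt_p : 1 < p
  one_lt_r : 1 < r
  scaling : 1 / r = 2 / p + (2 * ν + κ) / d - 1
  kappa_lt : κ < d / r
  lt_nu : ((d : ℝ) - 1) / 2 * (1 - 2 / p) < ν
  nu_lt : ν < d * ((p - 1) / p)
  p_le : p ≤ 2 * r
  max_pos : 0 < max ν κ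
  nu_add_kappa : ((d : ℝ) - 1) * (1 / r - 1 / p) ≤ ν + κ
  lower : max 0 (d + p * ((γ - d - 1) + ν)) < d * (r - p) / r + p * (ν + κ + 1)
  upper : d * (r - p) / r + p * (ν + κ + 1) < γ * p * (r - 1) / r
  gap : γ < γ * p * (r - 1) / r - d * (r - p) / r - p * (ν + κ + 1)
  p_gt : r / (r - 1) < p

end LerayBlowup

end

namespace LerayBlowup

open MeasureTheory Set

variable {d : ℕ}

/-! The argument takes place in `L¹`. The bound on `ν` makes `1 / u_ν` lie in the conjugate Lebesgue
space, so Hölder embeds the weighted space in `L¹` (`exists_lintegral_enorm_le_wNorm`), and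
smallness there is enough. Put `β = 1 - 1/γ`, positive by `one_lt_gamma`, and `n = ‖ϑ‖₁`. By
scaling, the self-similar field has `L¹` norm `(T - t)^(-β) n`. In the Duhamel term the factor `|y|`
is absorbed by the dissipation at the cost of `(t - s)^(-1/γ)`, which is integrable in `s`, and the
convolution is bounded by the product of `L¹` norms (`SolvesNS.lintegral_le`). At the time when the
norm has doubled, the linear part accounts for at most half of it, so the quadratic part must supply
the rest. This gives `n β ≤ 8 n²`, in which `T` has cancelled; hence `n < β / 8` forces `n = 0`. -/

lemma Admissible.one_lt_gamma {γ p ν κ r : ℝ} (hd : 2 ≤ d) (h : Admissible d γ p ν κ r) :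
    1 < γ := by
  have hd0 : (0 : ℝ) < d := by exact_mod_cast (by omega : 0 < d)
  have hp : 0 < p := one_pos.trans h.one_lt_p
  have hr : 0 < r := one_pos.trans h.one_lt_r
  -- The scaling relation eliminates `κ` and `r`. With `ν < d (p - 1) / p` the result exceeds `p`,
  -- while `upper` puts it below `γ p`.
  have hA : d * (r - p) / r + p * (ν + κ + 1) = p * (d + 1 - ν) - d := by
    have h1 : d * (r - p) / r = d - d * p * (1 / r) := by field_simp
    rw [h1, h.scaling]
    field_simp
    ring
  have hν : p * ν < d * (p - 1) := by
    have := mul_lt_mul_of_pos_left h.nu_lt hp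
    rwa [show p * (d * ((p - 1) / p)) = d * (p - 1) by field_simp] at this
  have hpos : 0 < d * (r - p) / r + p * (ν + κ + 1) := (le_max_left _ _).trans_lt h.lower
  have hup := h.upper
  have hgap := h.gap
  have hγp : γ * p * (r - 1) / r = γ * (p * ((r - 1) / r)) := by ring
  have hfrac : 0 < (r - 1) / r := div_pos (by linarith [h.one_lt_r]) hr
  have hfrac' : (r - 1) / r < 1 := by rw [div_lt_one hr]; linarith
  have hγ : 0 < γ := by
    rw [hγp] at hup
    exact pos_of_mul_pos_left (hpos.trans hup) (by positivity)
  have h2 : γ * p * (r - 1) / r < γ * p := by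
    rw [mul_div_assoc]
    exact mul_lt_of_lt_one_right (by positivity) hfrac'
  have h3 : p * 1 < p * γ := by nlinarith
  exact lt_of_mul_lt_mul_left h3 hp.le

/-! ### Pointwise bounds on the nonlinearity -/

lemma norm_toC (y : RSp d) : ‖toC y‖ = ‖y‖ := by
  simp [toC, EuclideanSpace.norm_eq]

lemma dot_eq_inner (y : RSp d) (w : CSp d) : dot y w = inner ℂ (toC y) w := by
  simp [dot, toC, PiLp.inner_apply, mul_comm]

lemma norm_dot_le (y : RSp d) (w : CSp d) : ‖dot y w‖ ≤ ‖y‖ * ‖w‖ := by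
  rw [dot_eq_inner, ← norm_toC y]
  exact norm_inner_le_norm _ _

lemma norm_lerayProj_le (y : RSp d) (w : CSp d) : ‖lerayProj y w‖ ≤ 2 * ‖w‖ := by
  have h : ‖(dot y w / ((‖y‖ ^ 2 : ℝ) : ℂ)) • toC y‖ ≤ ‖w‖ := by
    rw [norm_smul, norm_div, norm_toC, Complex.norm_real, Real.norm_of_nonneg (by positivity)]
    -- At `y = 0` the quotient is `0` by the convention on division.
    rcases (norm_nonneg y).eq_or_lt with h0 | h0
    · simp [← h0]
    · rw [div_mul_eq_mul_div, div_le_iff₀ (by positivity)]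
      nlinarith [norm_dot_le y w]
  calc ‖lerayProj y w‖ ≤ ‖w‖ + ‖(dot y w / ((‖y‖ ^ 2 : ℝ) : ℂ)) • toC y‖ := norm_sub_le _ _
    _ ≤ 2 * ‖w‖ := by linarith

/-- The smoothing estimate for the dissipation semigroup. -/
lemma mul_exp_neg_rpow_mul_le {γ a b : ℝ} (hγ : 1 ≤ γ) (ha : 0 ≤ a) (hb : 0 < b) :
    a * Real.exp (-a ^ γ * b) ≤ b ^ (-(1 / γ)) := by
  have hγ0 : 0 < γ := one_pos.trans_le hγ
  have key : ∀ x : ℝ, 0 ≤ x → x * Real.exp (-x ^ γ) ≤ 1 := by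
    intro x hx
    rcases le_total x 1 with h1 | h1
    · exact mul_le_one₀ h1 (Real.exp_nonneg _)
        (Real.exp_le_one_iff.2 (neg_nonpos.2 (Real.rpow_nonneg hx _)))
    · have h2 : x ≤ Real.exp (x ^ γ) :=
        calc x ≤ x ^ γ := Real.self_le_rpow_of_one_le h1 hγ
          _ ≤ Real.exp (x ^ γ) := by linarith [Real.add_one_le_exp (x ^ γ)]
      rw [Real.exp_neg, ← div_eq_mul_inv, div_le_one (Real.exp_pos _)]
      exact h2
  have hb' : 0 < b ^ (1 / γ) := Real.rpow_pos_of_pos hb _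
  -- Rescaling reduces to `b = 1`.
  have := key (a * b ^ (1 / γ)) (by positivity)
  rw [Real.mul_rpow ha hb'.le, ← Real.rpow_mul hb.le, one_div_mul_cancel hγ0.ne',
    Real.rpow_one] at this
  rw [Real.rpow_neg hb.le, ← one_div, le_div_iff₀ hb', neg_mul]
  calc _ = a * b ^ (1 / γ) * Real.exp (-(a ^ γ * b)) := by ring
    _ ≤ 1 := this

lemma enorm_nonlinearity_le {γ t s : ℝ} (hγ : 1 ≤ γ) (hst : s < t) (v : RSp d → ℝ → CSp d)
    (y z : RSp d) :
    ‖nonlinearity γ v y t s z‖ₑ ≤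
      ENNReal.ofReal (2 * (t - s) ^ (-(1 / γ))) * (‖v (y - z) s‖ₑ * ‖v z s‖ₑ) := by
  have h : ‖nonlinearity γ v y t s z‖ ≤
      2 * (t - s) ^ (-(1 / γ)) * (‖v (y - z) s‖ * ‖v z s‖) := by
    rw [nonlinearity, norm_smul, norm_smul, Real.norm_of_nonneg (Real.exp_nonneg _)]
    calc Real.exp (-‖y‖ ^ γ * (t - s)) * (‖dot y (v (y - z) s)‖ * ‖lerayProj y (v z s)‖)
        ≤ Real.exp (-‖y‖ ^ γ * (t - s)) * ((‖y‖ * ‖v (y - z) s‖) * (2 * ‖v z s‖)) := by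
          gcongr
          · exact norm_dot_le _ _
          · exact norm_lerayProj_le _ _
      _ = 2 * (‖y‖ * Real.exp (-‖y‖ ^ γ * (t - s))) * (‖v (y - z) s‖ * ‖v z s‖) := by ring
      _ ≤ _ := by
          gcongr
          exact mul_exp_neg_rpow_mul_le hγ (norm_nonneg _) (sub_pos.2 hst)
  rw [← ofReal_norm, ← ofReal_norm, ← ofReal_norm, ← ENNReal.ofReal_mul (norm_nonneg _),
    ← ENNReal.ofReal_mul (mul_nonneg zero_le_two (Real.rpow_nonneg (sub_pos.2 hst).le _))]
  exact ENNReal.ofReal_le_ofReal h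

/-! ### Scaling, convolution and time integrals -/

lemma lintegral_comp_smul (F : RSp d → ENNReal) (hF : Measurable F) {c : ℝ} (hc : 0 < c) :
    ∫⁻ x, F (c • x) = ENNReal.ofReal (c ^ (-(d : ℝ))) * ∫⁻ x, F x := by
  rw [← lintegral_map hF (measurable_const_smul c), Measure.map_addHaar_smul volume hc.ne',
    lintegral_smul_measure, finrank_euclideanSpace_fin, abs_of_pos (by positivity),
    Real.rpow_neg hc.le, Real.rpow_natCast, smul_eq_mul]

lemma lintegral_enorm_selfSimilar {γ T t : ℝ} (hγ : 0 < γ) (ht : t < T) {ϑ : RSp d → CSp d}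
    (hϑ : StronglyMeasurable ϑ) :
    ∫⁻ y, ‖selfSimilar γ T ϑ y t‖ₑ =
      ENNReal.ofReal ((T - t) ^ (-(1 - 1 / γ))) * ∫⁻ y, ‖ϑ y‖ₑ := by
  have h0 : 0 < T - t := sub_pos.2 ht
  simp only [selfSimilar, enorm_smul]
  rw [lintegral_const_mul _ (by fun_prop),
    lintegral_comp_smul (fun x => ‖ϑ x‖ₑ) (by fun_prop) (Real.rpow_pos_of_pos h0 _), ← mul_assoc,
    Real.enorm_of_nonneg (Real.rpow_nonneg h0.le _),
    ← ENNReal.ofReal_mul (Real.rpow_nonneg h0.le _), ← Real.rpow_mul h0.le, ← Real.rpow_add h0]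
  congr 3
  field_simp
  ring

lemma lintegral_lintegral_convolution (F : RSp d → ENNReal) (hF : Measurable F) :
    ∫⁻ y, ∫⁻ z, F (y - z) * F z = (∫⁻ y, F y) ^ 2 := by
  rw [lintegral_lintegral_swap (by fun_prop)]
  have : ∀ z, ∫⁻ y, F (y - z) * F z = (∫⁻ y, F y) * F z := fun z => by
    rw [lintegral_mul_const _ (by fun_prop), lintegral_sub_right_eq_self F z]
  simp_rw [this]
  rw [lintegral_const_mul _ hF, sq]

lemma measurable_lintegral_convolution {F : RSp d → ℝ → ENNReal}
    (hF : Measurable fun q : RSp d × ℝ => F q.1 q.2) :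
    Measurable fun q : RSp d × ℝ => ∫⁻ z, F (q.1 - z) q.2 * F z q.2 := by
  have m1 : Measurable fun a : (RSp d × ℝ) × RSp d => (a.1.1 - a.2, a.1.2) := by fun_prop
  have m2 : Measurable fun a : (RSp d × ℝ) × RSp d => (a.2, a.1.2) := by fun_prop
  exact ((hF.comp m1).mul (hF.comp m2)).lintegral_prod_right'

lemma selfSimilar_congr_ae {γ T t : ℝ} (ht : t < T) {ϑ g : RSp d → CSp d}
    (h : ϑ =ᵐ[volume] g) :
    (fun y => selfSimilar γ T ϑ y t) =ᵐ[volume] fun y => selfSimilar γ T g y t := by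
  have hc : (T - t) ^ (1 / γ) ≠ 0 := (Real.rpow_pos_of_pos (sub_pos.2 ht) _).ne'
  filter_upwards [(Measure.quasiMeasurePreserving_smul volume hc).ae h] with y hy
  simp only [selfSimilar, hy]

lemma lintegral_Ioo_sub_rpow {t β : ℝ} (ht : 0 < t) (hβ : 0 < β) :
    ∫⁻ s in Ioo 0 t, ENNReal.ofReal (2 * (t - s) ^ (-(1 - β))) =
      ENNReal.ofReal (2 * (t ^ β / β)) := by
  have hint : IntervalIntegrable (fun s : ℝ => 2 * (t - s) ^ (-(1 - β))) volume 0 t := by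
    have := (intervalIntegral.intervalIntegrable_rpow' (a := t) (b := 0)
      (r := -(1 - β)) (by linarith)).comp_sub_left t
    simpa using this.const_mul 2
  have hval : ∫ s in (0 : ℝ)..t, 2 * (t - s) ^ (-(1 - β)) = 2 * (t ^ β / β) := by
    rw [intervalIntegral.integral_const_mul,
      intervalIntegral.integral_comp_sub_left (fun x => x ^ (-(1 - β))) t,
      integral_rpow (Or.inl (by linarith))]
    simp [hβ.ne']
  rw [intervalIntegral.integral_of_le ht.le, integral_Ioc_eq_integral_Ioo] at hval
  rw [← hval, ofReal_integral_eq_lintegral_ofReal]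
  · exact ((intervalIntegrable_iff_integrableOn_Ioc_of_le ht.le).1 hint).mono_set
      Ioo_subset_Ioc_self
  · filter_upwards [ae_restrict_mem measurableSet_Ioo] with s hs
    exact mul_nonneg zero_le_two (Real.rpow_nonneg (sub_pos.2 hs.2).le _)

/-- Tonelli moves the frequency integral inside, where the convolution integrates to the square of
the `L¹` norm at time `s`. -/
lemma lintegral_lintegral_mul_convolution_le {t : ℝ} {k : ℝ → ENNReal} (hk : Measurable k)
    {F : RSp d → ℝ → ENNReal} (hF : Measurable fun q : RSp d × ℝ => F q.1 q.2) {M : ENNReal}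
    (hM : ∀ s ∈ Ioo 0 t, ∫⁻ y, F y s ≤ M) :
    ∫⁻ y, ∫⁻ s in Ioo 0 t, k s * ∫⁻ z, F (y - z) s * F z s ≤
      (∫⁻ s in Ioo 0 t, k s) * M ^ 2 := by
  have hm : Measurable fun q : RSp d × ℝ => k q.2 * ∫⁻ z, F (q.1 - z) q.2 * F z q.2 :=
    (hk.comp measurable_snd).mul (measurable_lintegral_convolution hF)
  rw [lintegral_lintegral_swap hm.aemeasurable, ← lintegral_mul_const _ hk]
  refine setLIntegral_mono' measurableSet_Ioo fun s hs => ?_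
  have hFs : Measurable fun y => F y s := hF.comp (measurable_id.prodMk measurable_const)
  have hc : Measurable fun y => ∫⁻ z, F (y - z) s * F z s :=
    (measurable_lintegral_convolution hF).comp (measurable_id.prodMk measurable_const)
  rw [lintegral_const_mul _ hc, lintegral_lintegral_convolution _ hFs]
  gcongr
  exact hM s hs

/-! ### The `L¹` estimate and its consequence -/

/-- The field `w` stands for a measurable representative of `v`, as Tonelli will need joint
measurability. Agreement almost everywhere at each time suffices, because `z ↦ y - z` preserves null
sets. -/
lemma SolvesNS.ae_enorm_le {γ T t : ℝ} (hγ : 1 ≤ γ) (ht : 0 < t) (htT : t < T)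
    {v w : RSp d → ℝ → CSp d} (hvw : ∀ s < T, ∀ᵐ y, v y s = w y s) (h : SolvesNS γ T v) :
    ∀ᵐ y, ‖w y t‖ₑ ≤ ‖w y 0‖ₑ +
      ∫⁻ s in Ioo 0 t, ENNReal.ofReal (2 * (t - s) ^ (-(1 / γ))) *
        ∫⁻ z, ‖w (y - z) s‖ₑ * ‖w z s‖ₑ := by
  filter_upwards [h.2 t ⟨ht, htT⟩, hvw t htT, hvw 0 (ht.trans htT)] with y hy hyt hy0
  rw [← hyt, ← hy0, hy.2]
  refine enorm_sub_le.trans (add_le_add ?_ ?_)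
  · rw [enorm_smul]
    refine mul_le_of_le_one_left' ?_
    rw [Real.enorm_of_nonneg (Real.exp_nonneg _), ENNReal.ofReal_le_one, Real.exp_le_one_iff,
      neg_mul, neg_nonpos]
    positivity
  · have hI : ‖Complex.I‖ₑ = 1 := by simp [← ofReal_norm]
    rw [enorm_smul, intervalIntegral.integral_of_le ht.le, integral_Ioc_eq_integral_Ioo, hI,
      one_mul]
    refine (enorm_integral_le_lintegral_enorm _).trans ?_
    refine setLIntegral_mono' measurableSet_Ioo fun s hs => ?_
    have hsT := hs.2.trans htT
    refine (enorm_integral_le_lintegral_enorm _).trans ?_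
    refine (lintegral_mono fun z => enorm_nonlinearity_le hγ hs.2 v y z).trans ?_
    rw [lintegral_const_mul' _ _ ENNReal.ofReal_ne_top]
    refine mul_le_mul_right (le_of_eq (lintegral_congr_ae ?_)) _
    filter_upwards [hvw s hsT,
      (quasiMeasurePreserving_sub_left_of_right_invariant volume y).ae (hvw s hsT)] with z h1 h2
    rw [h1, h2]

lemma measurable_enorm_selfSimilar {γ T : ℝ} {ϑ : RSp d → CSp d} (hϑ : StronglyMeasurable ϑ) :
    Measurable fun q : RSp d × ℝ => ‖selfSimilar γ T ϑ q.1 q.2‖ₑ := by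
  have := hϑ.measurable
  simp only [selfSimilar]
  fun_prop

/-- The `L¹` estimate obtained by integrating the equation over the frequency variable. -/
lemma SolvesNS.lintegral_le {γ T t : ℝ} (hγ : 1 < γ) (ht : 0 < t) (htT : t < T)
    {ϑ : RSp d → CSp d} (hϑ : AEStronglyMeasurable ϑ volume)
    (h : SolvesNS γ T (selfSimilar γ T ϑ)) :
    ENNReal.ofReal ((T - t) ^ (-(1 - 1 / γ))) * ∫⁻ y, ‖ϑ y‖ₑ ≤
      ENNReal.ofReal (T ^ (-(1 - 1 / γ))) * (∫⁻ y, ‖ϑ y‖ₑ) +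
      ENNReal.ofReal (2 * (t ^ (1 - 1 / γ) / (1 - 1 / γ))) *
        (ENNReal.ofReal ((T - t) ^ (-(1 - 1 / γ))) * ∫⁻ y, ‖ϑ y‖ₑ) ^ 2 := by
  obtain ⟨g, hg, hϑg⟩ := hϑ
  have hγ0 : 0 < γ := one_pos.trans hγ
  have hβ : 0 < 1 - 1 / γ := sub_pos.2 ((div_lt_one hγ0).2 hγ)
  have hint : ∫⁻ y, ‖ϑ y‖ₑ = ∫⁻ y, ‖g y‖ₑ := lintegral_congr_ae (hϑg.fun_comp fun x => ‖x‖ₑ)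
  have hmeas := measurable_enorm_selfSimilar (γ := γ) (T := T) hg
  have hN : ∀ s < T, ∫⁻ y, ‖selfSimilar γ T g y s‖ₑ =
      ENNReal.ofReal ((T - s) ^ (-(1 - 1 / γ))) * ∫⁻ y, ‖g y‖ₑ :=
    fun s hs => lintegral_enorm_selfSimilar hγ0 hs hg
  have hbound := h.ae_enorm_le hγ.le ht htT (w := selfSimilar γ T g)
    fun s hs => selfSimilar_congr_ae hs hϑg
  have hw0 : Measurable fun y => ‖selfSimilar γ T g y 0‖ₑ := by
    have := hg.measurable
    simp only [selfSimilar]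
    fun_prop
  have hk := lintegral_Ioo_sub_rpow ht hβ
  rw [sub_sub_cancel] at hk
  have hconv := lintegral_lintegral_mul_convolution_le (t := t)
    (k := fun s => ENNReal.ofReal (2 * (t - s) ^ (-(1 / γ)))) (by fun_prop)
    (F := fun y s => ‖selfSimilar γ T g y s‖ₑ) hmeas
    -- The norm `(T - s)^(-β) n` increases with `s`, so its value at `t` bounds it on `(0, t)`.
    (M := ENNReal.ofReal ((T - t) ^ (-(1 - 1 / γ))) * ∫⁻ y, ‖g y‖ₑ) fun s hs => by
      rw [hN s (hs.2.trans htT)]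
      refine mul_le_mul_left (ENNReal.ofReal_le_ofReal ?_) _
      exact Real.rpow_le_rpow_of_nonpos (sub_pos.2 htT) (by linarith [hs.2]) (by linarith)
  rw [hk] at hconv
  have hstart := lintegral_mono_ae hbound
  rw [lintegral_add_left hw0, hN t htT, hN 0 (ht.trans htT), sub_zero] at hstart
  rw [hint]
  exact hstart.trans (add_le_add le_rfl hconv)

/-- A self-similar solution whose profile is small in `L¹` is trivial. -/
lemma SolvesNS.ae_eq_zero_of_lintegral_lt {γ T : ℝ} (hγ : 1 < γ) (hT : 0 < T)
    {ϑ : RSp d → CSp d} (hϑ : AEStronglyMeasurable ϑ volume)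
    (hsmall : ∫⁻ y, ‖ϑ y‖ₑ < ENNReal.ofReal ((1 - 1 / γ) / 8))
    (h : SolvesNS γ T (selfSimilar γ T ϑ)) : ϑ =ᵐ[volume] 0 := by
  have hγ0 : 0 < γ := one_pos.trans hγ
  set β := 1 - 1 / γ with hβdef
  have hβ : 0 < β := sub_pos.2 ((div_lt_one hγ0).2 hγ)
  -- Chosen so that at `t = T (1 - a)` the factor `(T - t)^(-β)` is twice its initial value.
  set a : ℝ := (1 / 2) ^ (1 / β) with ha
  have ha0 : 0 < a := by positivity
  have ha1 : a < 1 := Real.rpow_lt_one (by norm_num) (by norm_num) (by positivity)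
  have haβ : a ^ β = 1 / 2 := by
    rw [ha, ← Real.rpow_mul (by norm_num), one_div_mul_cancel hβ.ne', Real.rpow_one]
  have ht : 0 < T * (1 - a) := mul_pos hT (by linarith)
  have htT : T * (1 - a) < T := by nlinarith
  have key := h.lintegral_le hγ ht htT hϑ
  rw [← hβdef, show T - T * (1 - a) = T * a by ring] at key
  obtain ⟨n, hn⟩ : ∃ n : NNReal, (n : ENNReal) = ∫⁻ y, ‖ϑ y‖ₑ :=
    ⟨_, ENNReal.coe_toNNReal (hsmall.trans ENNReal.ofReal_lt_top).ne⟩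
  have hn' : ∫⁻ y, ‖ϑ y‖ₑ = ENNReal.ofReal n := by rw [← hn, ENNReal.ofReal_coe_nnreal]
  have hTβ : 0 < T ^ β := Real.rpow_pos_of_pos hT _
  have h1 : (T * a) ^ (-β) = 2 * (T ^ β)⁻¹ := by
    rw [Real.rpow_neg (by positivity), Real.mul_rpow hT.le ha0.le, haβ, mul_inv]
    norm_num
    ring
  have h2 : (T * (1 - a)) ^ β ≤ T ^ β := Real.rpow_le_rpow ht.le htT.le hβ.le
  have h3 : 0 ≤ (T * (1 - a)) ^ β := Real.rpow_nonneg ht.le _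
  have hn0 : (0 : ℝ) ≤ n := n.2
  rw [hn', h1, Real.rpow_neg hT.le, ← ENNReal.ofReal_mul (by positivity),
    ← ENNReal.ofReal_mul (by positivity), ← ENNReal.ofReal_pow (by positivity),
    ← ENNReal.ofReal_mul (by positivity), ← ENNReal.ofReal_add (by positivity) (by positivity),
    ENNReal.ofReal_le_ofReal_iff (by positivity)] at key
  have h4 : 2 * (T ^ β)⁻¹ * (n : ℝ) ≤ (T ^ β)⁻¹ * n +
      2 * (T ^ β / β) * (2 * (T ^ β)⁻¹ * n) ^ 2 := by
    refine key.trans ?_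
    gcongr
  have h5 : (n : ℝ) * β ≤ 8 * n ^ 2 := by
    have := mul_le_mul_of_nonneg_right h4 (mul_pos hTβ hβ).le
    field_simp at this
    nlinarith
  have h6 : (n : ℝ) < β / 8 := by
    rw [hn'] at hsmall
    exact (ENNReal.ofReal_lt_ofReal_iff (by positivity)).1 hsmall
  have h7 : (n : ℝ) = 0 := by
    by_contra hne
    have : 0 < (n : ℝ) := lt_of_le_of_ne hn0 (Ne.symm hne)
    nlinarith
  rw [h7, ENNReal.ofReal_zero] at hn'
  rw [lintegral_eq_zero_iff' hϑ.enorm] at hn'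
  filter_upwards [hn'] with y hy
  simpa using hy

/-! ### Embedding of the weighted space in `L¹` -/

lemma weight_pos (ν : ℝ) {x : RSp d} (hx : x ≠ 0) : 0 < weight ν x :=
  mul_pos (Real.exp_pos _) (Real.rpow_pos_of_pos (norm_pos_iff.2 hx) _)

lemma measurable_weight (ν : ℝ) : Measurable (weight ν : RSp d → ℝ) := by
  unfold weight
  fun_prop

lemma ae_eq_inv_weight_smul (hd : 2 ≤ d) (ν : ℝ) (f : RSp d → CSp d) :
    f =ᵐ[volume] (fun x : RSp d => (weight ν x)⁻¹) • fun x : RSp d => weight ν x • f x := by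
  have : Nonempty (Fin d) := ⟨⟨0, by omega⟩⟩
  filter_upwards [Measure.ae_ne volume (0 : RSp d)] with x hx
  simp [smul_smul, inv_mul_cancel₀ (weight_pos ν hx).ne']

lemma MemWeighted.aestronglyMeasurable (hd : 2 ≤ d) {p ν : ℝ} {f : RSp d → CSp d}
    (hf : MemWeighted p ν f) : AEStronglyMeasurable f volume :=
  ((measurable_weight ν).inv.aestronglyMeasurable.smul hf.1).congr
    (ae_eq_inv_weight_smul hd ν f).symm

lemma memLp_inv_weight (hd : 2 ≤ d) {q ν : ℝ} (hq : 1 < q) (hν : ν * q < d) :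
    MemLp (fun x : RSp d => (weight ν x)⁻¹) (ENNReal.ofReal q) volume := by
  have : Nonempty (Fin d) := ⟨⟨0, by omega⟩⟩
  have hq0 : 0 < q := one_pos.trans hq
  have hmeas : AEStronglyMeasurable (fun x : RSp d => (weight ν x)⁻¹) volume :=
    (measurable_weight ν).inv.aestronglyMeasurable
  rw [← integrable_norm_rpow_iff hmeas (by simpa using hq0) ENNReal.ofReal_ne_top, ENNReal.toReal_ofReal hq0.le]
  -- In polar coordinates the integrand is `s^(d - 1 - ν q) e^(-q s)`, integrable at `0` exactly
  -- because `ν q < d`.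
  refine (integrable_fun_norm_addHaar (E := RSp d) volume
    (f := fun s : ℝ => ‖(Real.exp s * s ^ ν)⁻¹‖ ^ q)).2 ?_
  rw [finrank_euclideanSpace_fin]
  refine (integrableOn_rpow_mul_exp_neg_mul_rpow (p := 1) (s := d - 1 - ν * q) (b := q)
    (by linarith) one_pos hq0).congr_fun (fun s hs => ?_) measurableSet_Ioi
  have hs0 : (0 : ℝ) < s := hs
  have hsν : 0 < s ^ ν := Real.rpow_pos_of_pos hs0 _
  simp only [smul_eq_mul, Real.rpow_one]
  rw [norm_inv, Real.norm_of_nonneg (by positivity), Real.inv_rpow (by positivity),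
    Real.mul_rpow (Real.exp_nonneg _) hsν.le, ← Real.exp_mul, ← Real.rpow_mul hs0.le,
    Real.rpow_sub hs0, mul_inv, ← Real.exp_neg, ← Real.rpow_natCast,
    Nat.cast_sub (by omega : 1 ≤ d), Nat.cast_one, show -q * s = -(s * q) by ring]
  ring

/-- The weighted space embeds continuously into `L¹`. -/
lemma exists_lintegral_enorm_le_wNorm (hd : 2 ≤ d) {p ν : ℝ} (hp : 1 < p)
    (hν : ν < d * ((p - 1) / p)) :
    ∃ K : ℝ, 0 < K ∧ ∀ f : RSp d → CSp d, MemWeighted p ν f →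
      ∫⁻ x, ‖f x‖ₑ ≤ ENNReal.ofReal K * wNorm p ν f := by
  have hpq := Real.HolderConjugate.conjExponent hp
  set q := p.conjExponent
  have hνq : ν * q < d := by
    have := mul_lt_mul_of_pos_right hν hpq.symm.pos
    have hp1 : 0 < p - 1 := by linarith
    rwa [show d * ((p - 1) / p) * q = d by
      simp only [q, Real.conjExponent]; field_simp] at this
  have hmem := memLp_inv_weight hd hpq.symm.lt hνq
  have htriple : ENNReal.HolderTriple (ENNReal.ofReal q) (ENNReal.ofReal p) 1 :=
    hpq.symm.ennrealOfReal
  -- The `+ 1` only serves to make the constant visibly positive.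
  refine ⟨(eLpNorm (fun x : RSp d => (weight ν x)⁻¹) (ENNReal.ofReal q) volume).toReal + 1,
    by positivity, fun f hf => ?_⟩
  rw [← eLpNorm_one_eq_lintegral_enorm, eLpNorm_congr_ae (ae_eq_inv_weight_smul hd ν f)]
  refine (eLpNorm_smul_le_mul_eLpNorm (p := ENNReal.ofReal q) (q := ENNReal.ofReal p)
    hf.1 hmem.1).trans ?_
  rw [wNorm]
  gcongr
  refine (ENNReal.le_ofReal_iff_toReal_le hmem.2.ne (by positivity)).2 (by linarith)

lemma exists_ae_eq_zero_of_wNorm_lt (hd : 2 ≤ d) {γ p ν κ r : ℝ}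
    (h : Admissible d γ p ν κ r) :
    ∃ D : ℝ, 0 < D ∧ ∀ (T : ℝ) (ϑ : RSp d → CSp d), 0 < T → MemWeighted p ν ϑ →
      wNorm p ν ϑ < ENNReal.ofReal D → SolvesNS γ T (selfSimilar γ T ϑ) →
      ϑ =ᵐ[volume] 0 := by
  have hγ := h.one_lt_gamma hd
  have hβ : 0 < 1 - 1 / γ := sub_pos.2 ((div_lt_one (one_pos.trans hγ)).2 hγ)
  obtain ⟨K, hK, hle⟩ := exists_lintegral_enorm_le_wNorm hd h.one_lt_p h.nu_lt
  refine ⟨(1 - 1 / γ) / 8 / K, by positivity, fun T ϑ hT hϑ hsmall hsol => ?_⟩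
  refine hsol.ae_eq_zero_of_lintegral_lt hγ hT (hϑ.aestronglyMeasurable hd) ?_
  calc ∫⁻ y, ‖ϑ y‖ₑ ≤ ENNReal.ofReal K * wNorm p ν ϑ := hle ϑ hϑ
    _ < ENNReal.ofReal K * ENNReal.ofReal ((1 - 1 / γ) / 8 / K) := by
      gcongr
      simp
    _ = ENNReal.ofReal ((1 - 1 / γ) / 8) := by
      rw [← ENNReal.ofReal_mul hK.le]
      congr 1
      field_simp

end LerayBlowup

theorem mainTheorem6 (d : ℕ) (hd : 2 ≤ d) (γ p ν κ r : ℝ)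
    (h : LerayBlowup.Admissible d γ p ν κ r) :
    ∃ D : ℝ, 0 < D ∧
      (∀ (T : ℝ) (ϑ : LerayBlowup.RSp d → LerayBlowup.CSp d), 0 < T →
        LerayBlowup.MemRadiallyDominated p ν ϑ →
        LerayBlowup.wNorm p ν ϑ < ENNReal.ofReal D →
        LerayBlowup.SolvesNS γ T (LerayBlowup.selfSimilar γ T ϑ) →
        ϑ =ᵐ[MeasureTheory.volume] 0) ∧
      (∀ (T : ℝ) (ϑ : LerayBlowup.RSp d → LerayBlowup.CSp d), 0 < T →
        LerayBlowup.MemRadial p ν ϑ →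
        LerayBlowup.wNorm p ν ϑ < ENNReal.ofReal D →
        LerayBlowup.SolvesNS γ T (LerayBlowup.selfSimilar γ T ϑ) →
        ϑ =ᵐ[MeasureTheory.volume] 0) := by
  obtain ⟨D, hD, hmain⟩ := LerayBlowup.exists_ae_eq_zero_of_wNorm_lt hd h
  exact ⟨D, hD, fun T ϑ hT hϑ => hmain T ϑ hT hϑ.1, fun T ϑ hT hϑ => hmain T ϑ hT hϑ.1⟩
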